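/- Let $\mathcal K$ be an essentially small, rigid tensor-triangulated category, i.e. an essentially small triangulated category with a symmetric monoidal structure $\otimes$ (unit $\mathbb 1$) which is exact in each variable and for which every object is strongly dualizable. Let $\mathrm{mod}\text{-}\mathcal K$ be its Freyd envelope, that is, the abelian category of finitely presented additive functors $\mathcal K^{\mathrm{op}}\to\mathrm{Ab}$, with the tensor product given by Day convolution, and let $\mathrm h:\mathcal K\to \mathrm{mod}\text{-}\mathcal K$, $x\mapsto \mathrm{Hom}_{\mathcal K}(-,x)$, be the Yoneda embedding. A *homological prime* of $\mathcal K$ is a maximal proper Serre $\otimes$-ideal $\mathcal B\subset \mathrm{mod}\text{-}\mathcal K$: a Serre subcategory $\mathcal B\neq \mathrm{mod}\text{-}\mathcal K$ such that $M\otimes N\in\mathcal B$ for all $M\in \mathrm{mod}\text{-}\mathcal K$ and $N\in\mathcal B$, and which is maximal among these under inclusion. The corresponding *homological residue field* is the composite $$\bar{\mathrm h}_{\mathcal B}:\ \mathcal K\xrightarrow{\ \mathrm h\ }\mathrm{mod}\text{-}\mathcal K\xrightarrow{\ Q_{\mathcal B}\ }(\mathrm{mod}\text{-}\mathcal K)/\mathcal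 B$$ of the Yoneda embedding with the Gabriel quotient by $\mathcal B$. Let $f:x\to y$ be a morphism in $\mathcal K$ such that $\bar{\mathrm h}_{\mathcal B}(f)=0$ for every homological prime $\mathcal B$ of $\mathcal K$. Then there exists an integer $n\ge 1$ such that $f^{\otimes n}=0$ in $\mathcal K$. -/

import Mathlib

open CategoryTheory Limits Opposite MonoidalCategory

universe w v u

namespace TTNilpotence

section FreydEnvelope

variable {K : Type u} [Category.{v} K]

lemma cokernel_surj {A B : Kᵒᵖ ⥤ AddCommGrpCat.{v}} (φ : A ⟶ B) (z : Kᵒᵖ)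
    (c : (cokernel φ : Kᵒᵖ ⥤ AddCommGrpCat.{v}).obj z) : ∃ b, (cokernel.π φ).app z b = c := by
  have : Epi ((cokernel.π φ).app z) := inferInstance
  exact (AddCommGrpCat.epi_iff_surjective _).1 this c

lemma cokernel_exact {A B : Kᵒᵖ ⥤ AddCommGrpCat.{v}} (φ : A ⟶ B) (z : Kᵒᵖ) (b : B.obj z) :
    (cokernel.π φ).app z b = 0 ↔ ∃ a, φ.app z a = b := by
  constructor
  · intro h
    have h1 := (ShortComplex.exact_cokernel φ).map ((evaluation _ _).obj z)
    exact (ShortComplex.ab_exact_iff _).1 h1 b h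
  · rintro ⟨a, rfl⟩
    have := congr_arg (fun t => t.app z a) (cokernel.condition φ)
    exact this

lemma kernel_inj {A B : Kᵒᵖ ⥤ AddCommGrpCat.{v}} (φ : A ⟶ B) (z : Kᵒᵖ) :
    Function.Injective ((kernel.ι φ).app z) := by
  have : Mono ((kernel.ι φ).app z) := inferInstance
  exact (AddCommGrpCat.mono_iff_injective _).1 this

lemma kernel_exact {A B : Kᵒᵖ ⥤ AddCommGrpCat.{v}} (φ : A ⟶ B) (z : Kᵒᵖ) (a : A.obj z) :
    φ.app z a = 0 ↔ ∃ k, (kernel.ι φ).app z k = a := by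
  constructor
  · intro h
    have h1 := (ShortComplex.exact_kernel φ).map ((evaluation _ _).obj z)
    exact (ShortComplex.ab_exact_iff _).1 h1 a h
  · rintro ⟨a, rfl⟩
    have := congr_arg (fun t => t.app z a) (kernel.condition φ)
    exact this

lemma map_comp_apply (M : Kᵒᵖ ⥤ AddCommGrpCat.{v}) {y z w : K} (u : z ⟶ y) (v : w ⟶ z)
    (m : M.obj (op y)) : M.map (v ≫ u).op m = M.map v.op (M.map u.op m) := by
  rw [op_comp, M.map_comp]; rfl

lemma map_id_apply (M : Kᵒᵖ ⥤ AddCommGrpCat.{v}) {y : K} (m : M.obj (op y)) :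
    M.map (𝟙 y).op m = m := by
  rw [op_id, M.map_id]; rfl

lemma nat_apply {M N : Kᵒᵖ ⥤ AddCommGrpCat.{v}} (φ : M ⟶ N) {y z : K} (u : z ⟶ y)
    (m : M.obj (op y)) : φ.app _ (M.map u.op m) = N.map u.op (φ.app _ m) :=
  ConcreteCategory.congr_hom (φ.naturality u.op) m

variable (K) [Preadditive K]

/-- The finitely presented right `K`-modules: the functors `Kᵒᵖ ⥤ Ab` that are cokernels of a
morphism `Hom(-, x) ⟶ Hom(-, y)` between representable functors.  (Such functors are automatically
additive, and when `K` has finite biproducts these are exactly the finitely presented objects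
of the category of additive functors `Kᵒᵖ ⥤ Ab`.) -/
def IsFinPres : ObjectProperty (Kᵒᵖ ⥤ AddCommGrpCat.{v}) := fun M =>
  ∃ (x y : K) (f : x ⟶ y), Nonempty (cokernel (preadditiveYoneda.map f) ≅ M)

/-- The Freyd envelope `mod-K` of `K`: the full subcategory of finitely presented objects in the
category of right `K`-modules. -/
abbrev FreydEnvelope := (IsFinPres K).FullSubcategory

variable {K}

/-- The element `m ∈ M(y)` generates `M` and the morphism `f : x ⟶ y` generates its relations. -/
structure Presents (M : Kᵒᵖ ⥤ AddCommGrpCat.{v}) {x y : K} (f : x ⟶ y) (m : M.obj (op y)) :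
    Prop where
  gen : ∀ (z : K) (a : M.obj (op z)), ∃ u : z ⟶ y, M.map u.op m = a
  rel : ∀ (z : K) (u : z ⟶ y), M.map u.op m = 0 ↔ ∃ v : z ⟶ x, v ≫ f = u

lemma map_add_apply (M : Kᵒᵖ ⥤ AddCommGrpCat.{v}) [M.Additive] {y z : K} (u v : z ⟶ y)
    (m : M.obj (op y)) : M.map (u + v).op m = M.map u.op m + M.map v.op m := by
  rw [op_add, M.map_add]; rfl

lemma map_sub_apply (M : Kᵒᵖ ⥤ AddCommGrpCat.{v}) [M.Additive] {y z : K} (u v : z ⟶ y)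
    (m : M.obj (op y)) : M.map (u - v).op m = M.map u.op m - M.map v.op m := by
  rw [op_sub, M.map_sub]; rfl

/-- The natural transformation `Hom(-, y) ⟶ M` classified by `m ∈ M(y)`. -/
def yonedaDesc (M : Kᵒᵖ ⥤ AddCommGrpCat.{v}) [M.Additive] {y : K} (m : M.obj (op y)) :
    preadditiveYoneda.obj y ⟶ M where
  app z := AddCommGrpCat.ofHom (AddMonoidHom.mk' (fun u : z.unop ⟶ y => M.map u.op m)
    (fun u v => map_add_apply M u v m))
  naturality z z' u := by
    ext t
    exact map_comp_apply M t u.unop m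

lemma exists_presents {M : Kᵒᵖ ⥤ AddCommGrpCat.{v}} {x y : K} {f : x ⟶ y}
    (e : cokernel (preadditiveYoneda.map f) ≅ M) :
    M.Additive ∧ ∃ m : M.obj (op y), Presents M f m := by
  let p : preadditiveYoneda.obj y ⟶ M := cokernel.π (preadditiveYoneda.map f) ≫ e.hom
  have hinj : ∀ z, Function.Injective (e.hom.app z) := fun z =>
    (AddCommGrpCat.mono_iff_injective _).1 (inferInstance : Mono (e.hom.app z))
  have hps : ∀ z (a : M.obj (op z)), ∃ u : z ⟶ y, p.app (op z) u = a := by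
    intro z a
    obtain ⟨b, hb⟩ := (AddCommGrpCat.epi_iff_surjective _).1
      (inferInstance : Epi (e.hom.app (op z))) a
    obtain ⟨u, hu⟩ := cokernel_surj _ _ b
    refine ⟨u, ?_⟩
    rw [← hb, ← hu]; rfl
  have hp0 : ∀ z (u : z ⟶ y), p.app (op z) u = 0 ↔ ∃ v : z ⟶ x, v ≫ f = u := by
    intro z u
    refine Iff.trans ?_ (cokernel_exact (preadditiveYoneda.map f) (op z) u)
    rw [← (injective_iff_map_eq_zero' _).1 (hinj (op z))]
    rfl
  have hpm : ∀ z (u : z ⟶ y), M.map u.op (p.app (op y) (𝟙 y)) = p.app (op z) u := by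
    intro z u
    refine (nat_apply p u _).symm.trans ?_
    congr 1
    exact Category.comp_id u
  refine ⟨⟨?_⟩, p.app (op y) (𝟙 y), ?_, ?_⟩
  · intro a b s t
    ext c
    obtain ⟨u, rfl⟩ := hps a.unop c
    have h1 := nat_apply p s.unop u
    have h2 := nat_apply p t.unop u
    have h3 := nat_apply p (s.unop + t.unop) u
    change M.map (s + t) _ = M.map s _ + M.map t _
    refine h3.symm.trans (Eq.trans ?_ (congr_arg₂ (· + ·) h1 h2))
    change _ = p.app _ _ + p.app _ _
    rw [← map_add]
    congr 1
    exact Preadditive.add_comp _ _ _ _ _ _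
  · intro z a
    obtain ⟨u, hu⟩ := hps z a
    exact ⟨u, (hpm z u).trans hu⟩
  · intro z u
    rw [hpm, hp0]

lemma isFinPres_iff (M : Kᵒᵖ ⥤ AddCommGrpCat.{v}) :
    IsFinPres K M ↔ M.Additive ∧
      ∃ (x y : K) (f : x ⟶ y) (m : M.obj (op y)), Presents M f m := by
  constructor
  · rintro ⟨x, y, f, ⟨e⟩⟩
    obtain ⟨h, m, hm⟩ := exists_presents e
    exact ⟨h, x, y, f, m, hm⟩
  · rintro ⟨hM, x, y, f, m, hm⟩
    refine ⟨x, y, f, ⟨?_⟩⟩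
    have h0 : preadditiveYoneda.map f ≫ yonedaDesc M m = 0 := by
      ext z t
      exact (hm.rel _ _).2 ⟨t, rfl⟩
    let d := cokernel.desc _ _ h0
    have hd : ∀ z t, d.app z ((cokernel.π (preadditiveYoneda.map f)).app z t) =
        (yonedaDesc M m).app z t := by
      intro z t
      exact congr_arg (fun s => s.app z t) (cokernel.π_desc _ _ h0)
    have : ∀ z, IsIso (d.app z) := by
      intro z
      have h1 : Epi (d.app z) := by
        rw [AddCommGrpCat.epi_iff_surjective]
        intro a
        obtain ⟨t, ht⟩ := hm.gen z.unop a
        exact ⟨_, (hd z t).trans ht⟩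
      have h2 : Mono (d.app z) := by
        rw [AddCommGrpCat.mono_iff_injective, injective_iff_map_eq_zero]
        intro a ha
        obtain ⟨t, rfl⟩ := cokernel_surj _ _ a
        rw [hd] at ha
        rw [cokernel_exact]
        exact (hm.rel z.unop t).1 ha
      exact isIso_of_mono_of_epi _
    have : IsIso d := NatIso.isIso_of_isIso_app d
    exact asIso d

instance : (IsFinPres K).IsClosedUnderIsomorphisms where
  of_iso e := fun ⟨x, y, f, ⟨i⟩⟩ => ⟨x, y, f, ⟨i ≪≫ e⟩⟩


lemma exists_cover [HasBinaryBiproducts K] [HasWeakKernels K] {N : Kᵒᵖ ⥤ AddCommGrpCat.{v}}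
    (hN : IsFinPres K N) {y : K} (n : N.obj (op y)) :
    ∃ (x : K) (g : x ⟶ y), ∀ (z : K) (u : z ⟶ y),
      N.map u.op n = 0 ↔ ∃ v : z ⟶ x, v ≫ g = u := by
  obtain ⟨hadd, x', y', f, m, hm⟩ := (isFinPres_iff N).1 hN
  obtain ⟨h, rfl⟩ := hm.gen _ n
  let t : y ⊞ x' ⟶ y' := biprod.desc h (-f)
  refine ⟨weakKernel t, weakKernel.ι t ≫ biprod.fst, fun z u => ?_⟩
  rw [← map_comp_apply, hm.rel]
  constructor
  · rintro ⟨v, hv⟩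
    have h0 : biprod.lift u v ≫ t = 0 := by simp [t, hv]
    refine ⟨weakKernel.lift t _ h0, ?_⟩
    rw [← Category.assoc, weakKernel.lift_ι, biprod.lift_fst]
  · rintro ⟨v, rfl⟩
    refine ⟨v ≫ weakKernel.ι t ≫ biprod.snd, ?_⟩
    have h0 : weakKernel.ι t ≫ t = 0 := weakKernel.condition t
    have h1 : t = biprod.fst ≫ h - biprod.snd ≫ f := by
      ext <;> simp [t]
    have h2 : weakKernel.ι t ≫ biprod.fst ≫ h = weakKernel.ι t ≫ biprod.snd ≫ f := by
      rw [← sub_eq_zero, ← Preadditive.comp_sub, ← h1, h0]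
    simp only [Category.assoc]
    rw [h2]

lemma additive_of_mono {M N : Kᵒᵖ ⥤ AddCommGrpCat.{v}} [N.Additive] (i : M ⟶ N)
    (hi : ∀ z, Function.Injective (i.app z)) : M.Additive where
  map_add {a b s t} := by
    ext c
    apply hi
    have h1 := nat_apply i s.unop c
    have h2 := nat_apply i t.unop c
    have h3 := nat_apply i (s.unop + t.unop) c
    change i.app _ (M.map (s + t) c) = i.app _ (M.map s c + M.map t c)
    rw [map_add]
    refine h3.trans (Eq.trans ?_ (congr_arg₂ (· + ·) h1 h2).symm)
    exact map_add_apply N _ _ _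

lemma additive_of_epi {M N : Kᵒᵖ ⥤ AddCommGrpCat.{v}} [M.Additive] (p : M ⟶ N)
    (hp : ∀ z, Function.Surjective (p.app z)) : N.Additive where
  map_add {a b s t} := by
    ext c
    obtain ⟨c, rfl⟩ := hp _ c
    have h1 := nat_apply p s.unop c
    have h2 := nat_apply p t.unop c
    have h3 := nat_apply p (s.unop + t.unop) c
    change N.map (s + t) _ = N.map s _ + N.map t _
    refine h3.symm.trans (Eq.trans ?_ (congr_arg₂ (· + ·) h1 h2))
    rw [← map_add]
    congr 1
    exact map_add_apply M _ _ _

lemma isFinPres_kernel [HasBinaryBiproducts K] [HasWeakKernels K]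
    {M N : Kᵒᵖ ⥤ AddCommGrpCat.{v}} (φ : M ⟶ N) (hM : IsFinPres K M) (hN : IsFinPres K N) :
    IsFinPres K (kernel φ) := by
  obtain ⟨hadd, x, y, f, m, hm⟩ := (isFinPres_iff M).1 hM
  obtain ⟨z, g, hg⟩ := exists_cover hN (φ.app _ m)
  obtain ⟨w, k, hk⟩ := exists_cover hM (M.map g.op m)
  have h0 : φ.app _ (M.map g.op m) = 0 := by
    rw [nat_apply]
    exact (hg _ _).2 ⟨𝟙 z, Category.id_comp g⟩
  obtain ⟨e, he⟩ := (kernel_exact φ _ _).1 h0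
  refine (isFinPres_iff _).2 ⟨additive_of_mono (kernel.ι φ) (kernel_inj φ), w, z, k, e, ?_, ?_⟩
  · intro t a
    obtain ⟨u, hu⟩ := hm.gen t ((kernel.ι φ).app _ a)
    have h1 : N.map u.op (φ.app _ m) = 0 := by
      rw [← nat_apply, hu]
      exact (kernel_exact φ _ _).2 ⟨a, rfl⟩
    obtain ⟨v, rfl⟩ := (hg _ _).1 h1
    refine ⟨v, kernel_inj φ _ ?_⟩
    rw [nat_apply, he, ← hu, map_comp_apply]
  · intro t u
    rw [← hk, ← he, ← nat_apply]
    exact ((injective_iff_map_eq_zero' _).1 (kernel_inj φ _) _).symm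

lemma isFinPres_cokernel [HasBinaryBiproducts K]
    {M N : Kᵒᵖ ⥤ AddCommGrpCat.{v}} (φ : M ⟶ N) (hM : IsFinPres K M) (hN : IsFinPres K N) :
    IsFinPres K (cokernel φ) := by
  obtain ⟨haddM, x, y, f, m, hm⟩ := (isFinPres_iff M).1 hM
  obtain ⟨haddN, x', y', f', m', hm'⟩ := (isFinPres_iff N).1 hN
  obtain ⟨h, hh⟩ := hm'.gen _ (φ.app _ m)
  refine (isFinPres_iff _).2 ⟨additive_of_epi (cokernel.π φ) (cokernel_surj φ),
    x' ⊞ y, y', biprod.desc f' h, (cokernel.π φ).app _ m', ?_, ?_⟩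
  · intro t a
    obtain ⟨b, rfl⟩ := cokernel_surj φ _ a
    obtain ⟨u, rfl⟩ := hm'.gen t b
    exact ⟨u, (nat_apply _ _ _).symm⟩
  · intro t u
    rw [← nat_apply, cokernel_exact]
    constructor
    · rintro ⟨a, ha⟩
      obtain ⟨w, rfl⟩ := hm.gen t a
      have h1 : N.map (u - w ≫ h).op m' = 0 := by
        rw [map_sub_apply, map_comp_apply, hh, ← nat_apply, ha, sub_self]
      obtain ⟨v, hv⟩ := (hm'.rel _ _).1 h1
      exact ⟨biprod.lift v w, by simp [hv]⟩
    · rintro ⟨v, rfl⟩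
      refine ⟨M.map (v ≫ biprod.snd).op m, ?_⟩
      have h2 : N.map f'.op m' = 0 := (hm'.rel _ _).2 ⟨𝟙 _, Category.id_comp _⟩
      have h3 : v ≫ biprod.desc f' h =
          (v ≫ biprod.fst) ≫ f' + (v ≫ biprod.snd) ≫ h := by
        rw [biprod.desc_eq]; simp
      rw [h3, map_add_apply, map_comp_apply N f' (v ≫ biprod.fst), h2, map_zero, zero_add,
        map_comp_apply N h (v ≫ biprod.snd), hh, nat_apply]

open ZeroObject in
lemma isFinPres_yoneda [HasZeroObject K] (y : K) : IsFinPres K (preadditiveYoneda.obj y) := by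
  refine (isFinPres_iff _).2 ⟨inferInstance, 0, y, 0, 𝟙 y, ?_, ?_⟩
  · intro z a
    exact ⟨a, Category.comp_id _⟩
  · intro z u
    change u ≫ 𝟙 y = 0 ↔ _
    simp [eq_comm]

open ZeroObject in
instance [HasZeroObject K] : (IsFinPres K).ContainsZero where
  exists_zero := by
    refine ⟨preadditiveYoneda.obj (0 : K), ?_, isFinPres_yoneda _⟩
    rw [IsZero.iff_id_eq_zero]
    ext z t
    exact (isZero_zero K).eq_of_tgt _ _

instance [HasBinaryBiproducts K] [HasWeakKernels K] : (IsFinPres K).IsClosedUnderKernels where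
  kernels_le := by
    rintro _ ⟨φ, k, hk, hM, hN⟩
    exact (IsFinPres K).prop_of_iso ((kernelIsKernel φ).conePointUniqueUpToIso hk)
      (isFinPres_kernel φ hM hN)

instance [HasBinaryBiproducts K] : (IsFinPres K).IsClosedUnderCokernels where
  cokernels_le := by
    rintro _ ⟨φ, k, hk, hM, hN⟩
    exact (IsFinPres K).prop_of_iso ((cokernelIsCokernel φ).coconePointUniqueUpToIso hk)
      (isFinPres_cokernel φ hM hN)

lemma isFinPres_of_binaryBicone [HasBinaryBiproducts K] {M N : Kᵒᵖ ⥤ AddCommGrpCat.{v}}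
    (b : BinaryBicone M N) (hb : b.fst ≫ b.inl + b.snd ≫ b.inr = 𝟙 b.pt)
    (hM : IsFinPres K M) (hN : IsFinPres K N) :
    IsFinPres K b.pt := by
  obtain ⟨haddM, x, y, f, m, hm⟩ := (isFinPres_iff M).1 hM
  obtain ⟨haddN, x', y', f', m', hm'⟩ := (isFinPres_iff N).1 hN
  have hsum : ∀ z (c : b.pt.obj z),
      b.inl.app z (b.fst.app z c) + b.inr.app z (b.snd.app z c) = c := fun z c =>
    congr_arg (fun s => s.app z c) hb
  have h11 : ∀ z c, b.fst.app z (b.inl.app z c) = c := fun z c =>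
    congr_arg (fun s => s.app z c) b.inl_fst
  have h12 : ∀ z c, b.snd.app z (b.inl.app z c) = 0 := fun z c =>
    congr_arg (fun s => s.app z c) b.inl_snd
  have h21 : ∀ z c, b.fst.app z (b.inr.app z c) = 0 := fun z c =>
    congr_arg (fun s => s.app z c) b.inr_fst
  have h22 : ∀ z c, b.snd.app z (b.inr.app z c) = c := fun z c =>
    congr_arg (fun s => s.app z c) b.inr_snd
  have hext : ∀ z (c d : b.pt.obj z), b.fst.app z c = b.fst.app z d →
      b.snd.app z c = b.snd.app z d → c = d := by
    intro z c d h1 h2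
    rw [← hsum z c, ← hsum z d, h1, h2]
  have hadd : b.pt.Additive := by
    refine ⟨fun {r q s t} => ?_⟩
    ext c
    have key : ∀ {P : Kᵒᵖ ⥤ AddCommGrpCat.{v}} [P.Additive] (p : b.pt ⟶ P),
        p.app _ (b.pt.map (s + t) c) = p.app _ (b.pt.map s c + b.pt.map t c) := by
      intro P _ p
      rw [map_add]
      exact (nat_apply p (s.unop + t.unop) c).trans ((map_add_apply P _ _ _).trans
        (congr_arg₂ (· + ·) (nat_apply p s.unop c) (nat_apply p t.unop c)).symm)
    exact hext _ _ _ (key b.fst) (key b.snd)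
  let e := b.inl.app _ (M.map (biprod.fst : y ⊞ y' ⟶ y).op m) +
    b.inr.app _ (N.map (biprod.snd : y ⊞ y' ⟶ y').op m')
  have he1 : ∀ z (u : z ⟶ y ⊞ y'), b.fst.app _ (b.pt.map u.op e) =
      M.map (u ≫ biprod.fst).op m := by
    intro z u
    rw [nat_apply, map_add, h11, h21, add_zero, map_comp_apply]
  have he2 : ∀ z (u : z ⟶ y ⊞ y'), b.snd.app _ (b.pt.map u.op e) =
      N.map (u ≫ biprod.snd).op m' := by
    intro z u
    rw [nat_apply, map_add, h12, h22, zero_add, map_comp_apply]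
  refine (isFinPres_iff _).2 ⟨hadd, x ⊞ x', y ⊞ y', biprod.map f f', e, ?_, ?_⟩
  · intro z a
    obtain ⟨u, hu⟩ := hm.gen z (b.fst.app _ a)
    obtain ⟨w, hw⟩ := hm'.gen z (b.snd.app _ a)
    refine ⟨biprod.lift u w, hext _ _ _ ?_ ?_⟩
    · rw [he1, biprod.lift_fst, hu]
    · rw [he2, biprod.lift_snd, hw]
  · intro z u
    have h0 : b.pt.map u.op e = 0 ↔
        M.map (u ≫ biprod.fst).op m = 0 ∧ N.map (u ≫ biprod.snd).op m' = 0 := by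
      rw [← he1, ← he2]
      constructor
      · intro h; rw [h, map_zero, map_zero]; exact ⟨rfl, rfl⟩
      · rintro ⟨h1, h2⟩
        exact hext _ _ _ (h1.trans (map_zero _).symm) (h2.trans (map_zero _).symm)
    rw [h0, hm.rel, hm'.rel]
    constructor
    · rintro ⟨⟨v, hv⟩, ⟨w, hw⟩⟩
      refine ⟨biprod.lift v w, ?_⟩
      ext <;> simp [hv, hw]
    · rintro ⟨v, rfl⟩
      exact ⟨⟨v ≫ biprod.fst, by simp⟩, ⟨v ≫ biprod.snd, by simp⟩⟩

instance [HasBinaryBiproducts K] : (IsFinPres K).IsClosedUnderBinaryProducts where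
  limitsOfShape_le := by
    rintro X ⟨p⟩
    have h1 := isFinPres_of_binaryBicone
      (BinaryBiproduct.bicone (p.diag.obj ⟨.left⟩) (p.diag.obj ⟨.right⟩)) biprod.total
      (p.prop_diag_obj _) (p.prop_diag_obj _)
    refine (IsFinPres K).prop_of_iso ?_ h1
    exact IsLimit.conePointsIsoOfNatIso
      (BinaryBiproduct.isLimit (p.diag.obj ⟨.left⟩) (p.diag.obj ⟨.right⟩)) p.isLimit
      (diagramIsoPair p.diag).symm

instance [HasZeroObject K] [HasBinaryBiproducts K] : (IsFinPres K).IsClosedUnderFiniteProducts :=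
  ObjectProperty.IsClosedUnderFiniteProducts.mk'

/-- The Yoneda embedding `h : K ⥤ mod-K`. -/
noncomputable def yonedaEmbedding (K : Type u) [Category.{v} K] [Preadditive K] [HasZeroObject K] :
    K ⥤ FreydEnvelope K :=
  (IsFinPres K).lift preadditiveYoneda isFinPres_yoneda

end FreydEnvelope

section Tensor

variable {K : Type u} [Category.{v} K] [Preadditive K] [MonoidalCategory K]

/-- A natural family of biadditive pairings `M(a) × N(b) → T(a ⊗ b)`, i.e. a natural transformation
from the external tensor product of `M` and `N` to `T ∘ ⊗`. -/
structure Pairing (M N T : Kᵒᵖ ⥤ AddCommGrpCat.{v}) where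
  pair : ∀ a b : K, M.obj (op a) →+ N.obj (op b) →+ T.obj (op (a ⊗ b))
  naturality : ∀ {a a' b b' : K} (s : a' ⟶ a) (t : b' ⟶ b) (m : M.obj (op a)) (n : N.obj (op b)),
    T.map (s ⊗ₘ t).op (pair a b m n) = pair a' b' (M.map s.op m) (N.map t.op n)

/-- The pairing exhibits `T` as the Day convolution of `M` and `N` (the additive left Kan extension
of the external tensor product of `M` and `N` along `⊗`): every pairing of `M` and `N` with values
in a right `K`-module `P` factors uniquely through it. -/
def Pairing.IsUniversal {M N T : Kᵒᵖ ⥤ AddCommGrpCat.{v}} (β : Pairing M N T) : Prop :=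
  ∀ (P : Kᵒᵖ ⥤ AddCommGrpCat.{v}) [P.Additive] (γ : Pairing M N P),
    ∃! φ : T ⟶ P, ∀ (a b : K) (m : M.obj (op a)) (n : N.obj (op b)),
      φ.app (op (a ⊗ b)) (β.pair a b m n) = γ.pair a b m n

/-- `T` is a Day convolution of `M` and `N`. -/
def IsDayConvolution (M N T : Kᵒᵖ ⥤ AddCommGrpCat.{v}) : Prop :=
  ∃ β : Pairing M N T, β.IsUniversal

/-- Finitely presented modules have a finitely presented Day convolution. -/
theorem exists_isDayConvolution [HasBinaryBiproducts K] [MonoidalPreadditive K]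
    (M N : FreydEnvelope K) : ∃ T : FreydEnvelope K, IsDayConvolution M.obj N.obj T.obj := by
  obtain ⟨M, hM'⟩ := M
  obtain ⟨N, hN'⟩ := N
  obtain ⟨haddM, x, y, f, m, hm⟩ := (isFinPres_iff M).1 hM'
  obtain ⟨haddN, x', y', f', m', hm'⟩ := (isFinPres_iff N).1 hN'
  let d : (x ⊗ y') ⊞ (y ⊗ x') ⟶ y ⊗ y' := biprod.desc (f ▷ y') (y ◁ f')
  obtain ⟨haddT, e, he⟩ := exists_presents (Iso.refl (cokernel (preadditiveYoneda.map d)))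
  have hT : IsFinPres K (cokernel (preadditiveYoneda.map d)) := ⟨_, _, d, ⟨Iso.refl _⟩⟩
  generalize cokernel (preadditiveYoneda.map d) = T at haddT e he hT
  have h1 : ∀ {a b : K} (u₁ u₂ : a ⟶ y) (w : b ⟶ y'), M.map u₁.op m = M.map u₂.op m →
      T.map (u₁ ⊗ₘ w).op e = T.map (u₂ ⊗ₘ w).op e := by
    intro a b u₁ u₂ w h
    have h' : M.map (u₁ - u₂).op m = 0 := by rw [map_sub_apply, h, sub_self]
    obtain ⟨v, hv⟩ := (hm.rel _ _).1 h'
    rw [← sub_eq_zero, ← map_sub_apply, he.rel]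
    refine ⟨(v ⊗ₘ w) ≫ biprod.inl, ?_⟩
    have h2 : (u₁ ⊗ₘ w) = (v ≫ f) ⊗ₘ w + u₂ ⊗ₘ w := by
      rw [← MonoidalPreadditive.add_tensor, hv, sub_add_cancel]
    rw [h2, add_sub_cancel_right]
    simp only [d, Category.assoc, biprod.inl_desc]
    rw [← tensorHom_id, tensorHom_comp_tensorHom, Category.comp_id]
  have h2 : ∀ {a b : K} (u : a ⟶ y) (w₁ w₂ : b ⟶ y'), N.map w₁.op m' = N.map w₂.op m' →
      T.map (u ⊗ₘ w₁).op e = T.map (u ⊗ₘ w₂).op e := by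
    intro a b u w₁ w₂ h
    have h' : N.map (w₁ - w₂).op m' = 0 := by rw [map_sub_apply, h, sub_self]
    obtain ⟨v, hv⟩ := (hm'.rel _ _).1 h'
    rw [← sub_eq_zero, ← map_sub_apply, he.rel]
    refine ⟨(u ⊗ₘ v) ≫ biprod.inr, ?_⟩
    have h2 : (u ⊗ₘ w₁) = u ⊗ₘ (v ≫ f') + u ⊗ₘ w₂ := by
      rw [← MonoidalPreadditive.tensor_add, hv, sub_add_cancel]
    rw [h2, add_sub_cancel_right]
    simp only [d, Category.assoc, biprod.inr_desc]
    rw [← id_tensorHom, tensorHom_comp_tensorHom, Category.comp_id]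
  choose u hu using hm.gen
  choose w hw using hm'.gen
  have key : ∀ {a b : K} (s : a ⟶ y) (t : b ⟶ y'),
      T.map (u a (M.map s.op m) ⊗ₘ w b (N.map t.op m')).op e = T.map (s ⊗ₘ t).op e :=
    fun s t => (h1 _ _ _ (hu _ _)).trans (h2 _ _ _ (hw _ _))
  let β : Pairing M N T :=
    { pair := fun a b => AddMonoidHom.mk' (fun p => AddMonoidHom.mk'
        (fun q => T.map (u a p ⊗ₘ w b q).op e) (by
          intro q q'
          rw [← map_add_apply, ← MonoidalPreadditive.tensor_add]
          refine h2 _ _ _ ?_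
          rw [map_add_apply, hw, hw, hw])) (by
        intro p p'
        ext q
        change T.map _ e = T.map _ e + T.map _ e
        rw [← map_add_apply, ← MonoidalPreadditive.add_tensor]
        refine h1 _ _ _ ?_
        rw [map_add_apply, hu, hu, hu])
      naturality := by
        intro a a' b b' s t p q
        change T.map _ (T.map _ e) = T.map _ e
        rw [← map_comp_apply, tensorHom_comp_tensorHom, ← key]
        simp only [map_comp_apply, hu, hw] }
  have hβ : ∀ {a b : K} (s : a ⟶ y) (t : b ⟶ y'),
      β.pair a b (M.map s.op m) (N.map t.op m') = T.map (s ⊗ₘ t).op e := key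
  refine ⟨⟨T, hT⟩, β, fun P _ γ => ?_⟩
  have hβe : β.pair y y' m m' = e := by
    have := hβ (𝟙 y) (𝟙 y')
    rwa [id_tensorHom_id, map_id_apply, map_id_apply, map_id_apply] at this
  let c := γ.pair y y' m m'
  have hc : ∀ z (s : z ⟶ y ⊗ y'), T.map s.op e = 0 → P.map s.op c = 0 := by
    intro z s hs
    obtain ⟨v, rfl⟩ := (he.rel _ _).1 hs
    have hd : d = biprod.fst ≫ (f ▷ y') + biprod.snd ≫ (y ◁ f') := biprod.desc_eq
    have hf : M.map f.op m = 0 := (hm.rel _ _).2 ⟨𝟙 _, Category.id_comp _⟩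
    have hf' : N.map f'.op m' = 0 := (hm'.rel _ _).2 ⟨𝟙 _, Category.id_comp _⟩
    have e1 : P.map (f ▷ y').op c = 0 := by
      rw [← tensorHom_id]
      refine (γ.naturality f (𝟙 y') m m').trans ?_
      rw [hf, map_zero]; rfl
    have e2 : P.map (y ◁ f').op c = 0 := by
      rw [← id_tensorHom]
      refine (γ.naturality (𝟙 y) f' m m').trans ?_
      rw [hf', map_zero]
    rw [map_comp_apply, hd, map_add_apply, map_comp_apply P (f ▷ y'), e1,
      map_comp_apply P (y ◁ f'), e2, map_zero, map_zero, add_zero, map_zero]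
  have hc' : ∀ z (s t : z ⟶ y ⊗ y'), T.map s.op e = T.map t.op e →
      P.map s.op c = P.map t.op c := by
    intro z s t h
    rw [← sub_eq_zero, ← map_sub_apply]
    apply hc
    rw [map_sub_apply, h, sub_self]
  choose r hr using he.gen
  let φ : T ⟶ P :=
    { app := fun z => AddCommGrpCat.ofHom (AddMonoidHom.mk'
        (fun q : T.obj (op z.unop) => P.map (r z.unop q).op c) (by
          intro q q'
          rw [← map_add_apply]
          refine hc' _ _ _ ?_
          rw [map_add_apply, hr, hr, hr]))
      naturality := by
        intro z z' s
        ext q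
        change P.map _ c = P.map s (P.map _ c)
        refine Eq.trans ?_ (map_comp_apply P (r z.unop q) s.unop c)
        refine hc' _ _ _ ?_
        rw [hr, map_comp_apply, hr]
        rfl }
  have hφ : ∀ z (s : z ⟶ y ⊗ y'), φ.app (op z) (T.map s.op e) = P.map s.op c :=
    fun z s => hc' _ _ _ (hr _ _)
  refine ⟨φ, ?_, ?_⟩
  · intro a b p q
    obtain ⟨s, rfl⟩ := hm.gen a p
    obtain ⟨t, rfl⟩ := hm'.gen b q
    rw [hβ, hφ]
    exact γ.naturality s t m m'
  · intro ψ hψ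
    ext z q
    obtain ⟨s, rfl⟩ := he.gen z.unop q
    have h3 : ψ.app _ e = c := by
      rw [← hβe]; exact hψ _ _ _ _
    refine (nat_apply ψ s e).trans (Eq.trans ?_ (hφ z.unop s).symm)
    rw [h3]

/-- The tensor product of `mod-K`, given by Day convolution (well defined up to isomorphism). -/
noncomputable def tensorObj [HasBinaryBiproducts K] [MonoidalPreadditive K]
    (M N : FreydEnvelope K) : FreydEnvelope K :=
  (exists_isDayConvolution M N).choose

lemma isDayConvolution_tensorObj [HasBinaryBiproducts K] [MonoidalPreadditive K]
    (M N : FreydEnvelope K) : IsDayConvolution M.obj N.obj (tensorObj M N).obj :=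
  (exists_isDayConvolution M N).choose_spec

/-- A class of objects of `mod-K` is a `⊗`-ideal if `M ⊗ N` belongs to it for all `M` in `mod-K` and
all `N` in the class. -/
def IsTensorIdeal [HasBinaryBiproducts K] [MonoidalPreadditive K]
    (B : ObjectProperty (FreydEnvelope K)) : Prop :=
  ∀ M N : FreydEnvelope K, B N → B (tensorObj M N)

/-- The object `x^{⊗ n}`. -/
def tensorPow (x : K) : ℕ → K
  | 0 => 𝟙_ K
  | n + 1 => tensorPow x n ⊗ x

/-- The morphism `f^{⊗ n} : x^{⊗ n} ⟶ y^{⊗ n}`. -/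
def tensorPowMap {x y : K} (f : x ⟶ y) : ∀ n : ℕ, tensorPow x n ⟶ tensorPow y n
  | 0 => 𝟙 (𝟙_ K)
  | n + 1 => tensorPowMap f n ⊗ₘ f

end Tensor

section TensorTriangulated

variable (K : Type u) [Category.{v} K] [Preadditive K] [HasZeroObject K] [HasShift K ℤ]
  [∀ n : ℤ, (shiftFunctor K n).Additive] [Pretriangulated K] [MonoidalCategory K]

/-- The tensor product is exact in each variable: for every object `x` the functors `x ⊗ -` and
`- ⊗ x` commute with the shift in such a way that they preserve distinguished triangles. -/
class IsTensorExact : Prop where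
  exact_left : ∀ x : K, ∃ _ : (tensorLeft x).CommShift ℤ, (tensorLeft x).IsTriangulated
  exact_right : ∀ x : K, ∃ _ : (tensorRight x).CommShift ℤ, (tensorRight x).IsTriangulated

instance [IsTensorExact K] : MonoidalPreadditive K := by
  have hl : ∀ x : K, (tensorLeft x).Additive := fun x => by
    obtain ⟨_, _⟩ := IsTensorExact.exact_left x
    infer_instance
  have hr : ∀ x : K, (tensorRight x).Additive := fun x => by
    obtain ⟨_, _⟩ := IsTensorExact.exact_right x
    infer_instance
  exact
    { whiskerLeft_zero := fun {x y z} => (tensorLeft x).map_zero y z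
      zero_whiskerRight := fun {x y z} => (tensorRight x).map_zero y z
      whiskerLeft_add := fun {x _ _} f g => (tensorLeft x).map_add (f := f) (g := g)
      add_whiskerRight := fun {x _ _} f g => (tensorRight x).map_add (f := f) (g := g) }

variable {K} [IsTensorExact K]

/-- A homological prime of `K`: a maximal proper Serre `⊗`-ideal of `mod-K`. -/
class IsHomologicalPrime (B : ObjectProperty (FreydEnvelope K)) : Prop extends
    B.IsSerreClass where
  isTensorIdeal : IsTensorIdeal B
  ne_top : B ≠ ⊤
  eq_of_le : ∀ (C : ObjectProperty (FreydEnvelope K)) [C.IsSerreClass],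
    IsTensorIdeal C → C ≠ ⊤ → B ≤ C → B = C

/-- The homological residue field `K ⥤ mod-K ⥤ (mod-K)/B` at a homological prime `B`: the Yoneda
embedding followed by the Gabriel quotient, i.e. the localization of `mod-K` at the morphisms whose
kernel and cokernel lie in `B`. -/
noncomputable def homologicalResidueField (B : ObjectProperty (FreydEnvelope K))
    [IsHomologicalPrime B] : K ⥤ B.isoModSerre.Localization :=
  yonedaEmbedding K ⋙ B.isoModSerre.Q

end TensorTriangulated

end TTNilpotence

/-!
Write `h` for the Yoneda embedding and `ᘁy`, `xᘁ` for duals. By rigidity a morphism `f : x ⟶ y` has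
two transposes, `unitMate f : 𝟙 ⟶ y ⊗ xᘁ` and `counitMate f : x ⊗ ᘁy ⟶ 𝟙`, and for a module `M` the
conditions `f ⊗ M = 0`, `unitMate f ⊗ M = 0` and "`M(z) ⟶ M(z ⊗ x ⊗ ᘁy)` vanishes for all `z`" are
equivalent. The last one speaks only of elements of `M`, so it is the one used here (`KilledBy`).

Let `C` be the class of modules `M` with `f^{⊗ n} ⊗ M = 0` for some `n` (`annihilated`). It is a
Serre `⊗`-ideal (`annihilated_isSerreClass`, `annihilated_isTensorIdeal`).

* If `C` contains the unit `h(𝟙)`, then `f^{⊗ n} = 0` for some `n`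
  (`tensorPowMap_tensorHom_eq_zero_of_killedBy`).
* Otherwise Zorn's lemma gives a homological prime `B ⊇ C` (`exists_homologicalPrime_le`). As `f`
  vanishes in the residue field at `B`, the morphism `h(f)` factors through an object of `B`, and
  so does `h(unitMate f)`, because `B` is a `⊗`-ideal (`FactorsThrough.whiskerLeft`).
  The kernel of `h(unitMate f) : h(𝟙) ⟶ h(y ⊗ xᘁ)` is annihilated by `f`
  (`annihilated_kernel_unitMate`), hence lies in `C ⊆ B`. So modulo `B` the
  morphism `h(unitMate f)` is both zero and a monomorphism, which puts `h(𝟙)` in `B`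
  (`FactorsThrough.prop_yoneda`) and makes `B` everything (`eq_top_of_unit_mem`), a contradiction.

The tensor product of modules is accessible only through its universal property. That
`annihilated` is a `⊗`-ideal uses the uniqueness part, in the form that the values of a universal
pairing generate its target (`Pairing.IsUniversal.mem_of_pair_mem`).
-/

namespace TTNilpotence

/-! ### Morphisms of the Freyd envelope in terms of elements -/

section Modules

variable {K : Type u} [Category.{v} K] [Preadditive K]

lemma FreydEnvelope.additive (M : FreydEnvelope K) : M.obj.Additive :=
  ((isFinPres_iff _).1 M.property).1

/-- Cokernels of finitely presented modules are finitely presented, so the pointwise cokernel of an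
epimorphism of `mod-K` vanishes. -/
lemma app_surjective_of_epi [HasBinaryBiproducts K] {M N : FreydEnvelope K} (p : M ⟶ N) [Epi p]
    (z : K) : Function.Surjective (p.hom.app (op z)) := by
  intro n
  let Q : FreydEnvelope K := ⟨cokernel p.hom, isFinPres_cokernel _ M.property N.property⟩
  let q : N ⟶ Q := ObjectProperty.homMk (cokernel.π p.hom)
  have h : q = 0 := by
    rw [← cancel_epi p, comp_zero]
    apply ObjectProperty.hom_ext
    exact cokernel.condition p.hom
  have h1 : (cokernel.π p.hom).app (op z) n = 0 :=
    congr_arg (fun t : N ⟶ Q => t.hom.app (op z) n) h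
  exact (cokernel_exact _ _ _).1 h1

lemma epi_of_app_surjective {M N : FreydEnvelope K} (p : M ⟶ N)
    (hp : ∀ z, Function.Surjective (p.hom.app (op z))) : Epi p where
  left_cancellation φ ψ h := by
    apply ObjectProperty.hom_ext
    ext z n
    obtain ⟨m, rfl⟩ := hp z.unop n
    exact congr_arg (fun t => t.hom.app z m) h

variable [HasZeroObject K]

/-- The morphism `h(z) ⟶ M` classified by an element of `M(z)`. -/
noncomputable def FreydEnvelope.ofElement (M : FreydEnvelope K) {z : K} (m : M.obj.obj (op z)) :
    (yonedaEmbedding K).obj z ⟶ M :=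
  haveI := M.additive
  ObjectProperty.homMk (yonedaDesc M.obj m)

lemma FreydEnvelope.ofElement_app (M : FreydEnvelope K) {z a : K} (m : M.obj.obj (op z))
    (u : a ⟶ z) : (M.ofElement m).hom.app (op a) u = M.obj.map u.op m := rfl

lemma yoneda_hom_ext {M : FreydEnvelope K} {z : K} {φ ψ : (yonedaEmbedding K).obj z ⟶ M}
    (h : φ.hom.app (op z) (𝟙 z) = ψ.hom.app (op z) (𝟙 z)) : φ = ψ := by
  apply ObjectProperty.hom_ext
  ext a u
  have key : ∀ χ : (yonedaEmbedding K).obj z ⟶ M,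
      χ.hom.app a u = M.obj.map (Quiver.Hom.op (u : a.unop ⟶ z)) (χ.hom.app (op z) (𝟙 z)) := by
    intro χ
    refine Eq.trans ?_ (nat_apply χ.hom (u : a.unop ⟶ z) (𝟙 z))
    congr 1
    exact (Category.comp_id (u : a.unop ⟶ z)).symm
  rw [key, key, h]

/-- Elements are morphisms out of representable modules, which belong to `mod-K`. -/
lemma app_injective_of_mono {M N : FreydEnvelope K} (i : M ⟶ N) [Mono i] (z : K) :
    Function.Injective (i.hom.app (op z)) := by
  rw [injective_iff_map_eq_zero]
  intro m hm
  have h : M.ofElement m = 0 := by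
    rw [← cancel_mono i, zero_comp]
    apply yoneda_hom_ext
    change i.hom.app _ (M.obj.map (𝟙 z).op m) = 0
    rw [map_id_apply, hm]
  have h1 := M.ofElement_app m (𝟙 z)
  rw [h, map_id_apply] at h1
  exact h1.symm

lemma exists_app_eq_of_shortExact [HasBinaryBiproducts K] [HasWeakKernels K]
    {S : ShortComplex (FreydEnvelope K)} (hS : S.ShortExact) {z : K}
    (m : S.X₂.obj.obj (op z)) (hm : S.g.hom.app _ m = 0) : ∃ l, S.f.hom.app _ l = m := by
  have := hS.mono_f
  have h : S.X₂.ofElement m ≫ S.g = 0 := by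
    apply yoneda_hom_ext
    change S.g.hom.app _ (S.X₂.obj.map (𝟙 z).op m) = 0
    rw [map_id_apply, hm]
  refine ⟨(hS.exact.lift _ h).hom.app (op z) (𝟙 z), ?_⟩
  have h1 := congr_arg (fun t => t.hom.app (op z) (𝟙 z)) (hS.exact.lift_f _ h)
  refine Eq.trans h1 ?_
  exact map_id_apply _ _

lemma exists_epi_yoneda (M : FreydEnvelope K) :
    ∃ (y : K) (p : (yonedaEmbedding K).obj y ⟶ M), Epi p := by
  obtain ⟨_, _, y, _, m, hm⟩ := (isFinPres_iff _).1 M.property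
  exact ⟨y, M.ofElement m, epi_of_app_surjective _ fun z a => hm.gen z a⟩

end Modules

/-! ### Generation of a Day convolution by its pairing -/

section Generation

variable {K : Type u} [Category.{v} K] [Preadditive K]

/-- The pointwise quotient of a module by a family of subgroups stable under restriction. -/
def quotientModule (T : Kᵒᵖ ⥤ AddCommGrpCat.{v}) (U : ∀ z : K, AddSubgroup (T.obj (op z)))
    (hU : ∀ {z w : K} (u : w ⟶ z) (t : T.obj (op z)), t ∈ U z → T.map u.op t ∈ U w) :
    Kᵒᵖ ⥤ AddCommGrpCat.{v} where
  obj z := AddCommGrpCat.of (T.obj z ⧸ U z.unop)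
  map {z w} u := AddCommGrpCat.ofHom
    (QuotientAddGroup.map (U z.unop) (U w.unop) (T.map u).hom fun t ht => hU u.unop t ht)
  map_id z := by
    ext t
    exact congr_arg _ (map_id_apply T (y := z.unop) t)
  map_comp u w := by
    ext t
    exact congr_arg _ (map_comp_apply T u.unop w.unop t)

variable [MonoidalCategory K]

/-- The values of a universal pairing generate its target: uniqueness in the universal property,
applied to the projection onto the quotient by the submodule `U` and the zero morphism. -/
lemma Pairing.IsUniversal.mem_of_pair_mem {M N T : Kᵒᵖ ⥤ AddCommGrpCat.{v}} [T.Additive]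
    {β : Pairing M N T} (hβ : β.IsUniversal) (U : ∀ z : K, AddSubgroup (T.obj (op z)))
    (hU : ∀ {z w : K} (u : w ⟶ z) (t : T.obj (op z)), t ∈ U z → T.map u.op t ∈ U w)
    (h : ∀ (a b : K) (m : M.obj (op a)) (n : N.obj (op b)), β.pair a b m n ∈ U (a ⊗ b))
    (z : K) (t : T.obj (op z)) : t ∈ U z := by
  let π : T ⟶ quotientModule T U hU :=
    { app := fun z => AddCommGrpCat.ofHom (QuotientAddGroup.mk' (U z.unop))
      naturality := fun _ _ _ => rfl }
  have : (quotientModule T U hU).Additive :=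
    additive_of_epi π fun z => QuotientAddGroup.mk_surjective
  let γ : Pairing M N (quotientModule T U hU) :=
    { pair := fun _ _ => 0
      naturality := fun _ _ _ _ => map_zero _ }
  have h1 : π = 0 := (hβ _ γ).unique
    (fun a b m n => (QuotientAddGroup.eq_zero_iff _).2 (h a b m n)) (fun _ _ _ _ => rfl)
  have h2 : π.app (op z) t = 0 := by rw [h1]; rfl
  exact (QuotientAddGroup.eq_zero_iff t).1 h2

end Generation

/-! ### Transposes of a morphism in a rigid category -/

section Rigid

variable {K : Type u} [Category.{v} K] [MonoidalCategory K]

/-- The morphism `z ⊗ d ⟶ z ⊗ 𝟙 ≅ z` induced by `g : d ⟶ 𝟙`. -/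
def augment {d : K} (g : d ⟶ 𝟙_ K) (z : K) : z ⊗ d ⟶ z := z ◁ g ≫ (ρ_ z).hom

lemma augment_naturality {d : K} (g : d ⟶ 𝟙_ K) {z w : K} (k : z ⟶ w) :
    augment g z ≫ k = k ▷ d ≫ augment g w := by
  simp only [augment, Category.assoc]
  rw [← whisker_exchange_assoc, rightUnitor_naturality]

lemma augment_tensor {d : K} (g : d ⟶ 𝟙_ K) (a b : K) :
    augment g (a ⊗ b) = (α_ a b d).hom ≫ a ◁ augment g b := by
  simp [augment]

variable [RigidCategory K]

/-- The transpose `x ⊗ ᘁy ⟶ 𝟙` of a morphism `f : x ⟶ y`. -/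
def counitMate {x y : K} (f : x ⟶ y) : x ⊗ (ᘁy : K) ⟶ 𝟙_ K := f ▷ (ᘁy : K) ≫ ε_ (ᘁy : K) y

/-- The transpose `𝟙 ⟶ y ⊗ xᘁ` of a morphism `f : x ⟶ y`. -/
def unitMate {x y : K} (f : x ⟶ y) : 𝟙_ K ⟶ y ⊗ (xᘁ : K) := η_ x (xᘁ : K) ≫ f ▷ (xᘁ : K)

variable [Preadditive K] [MonoidalPreadditive K]

/-- The morphisms `a ⊗ x ⊗ ᘁy ⟶ a ⟶ b` and `j ⊗ f : a ⊗ x ⟶ b ⊗ y` correspond to each other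
under the adjunction `- ⊗ ᘁy ⊣ - ⊗ y`. -/
lemma tensorHom_eq_zero_of_augment_comp_eq_zero {x y : K} (f : x ⟶ y) {a b : K} (j : a ⟶ b)
    (h : augment (counitMate f) a ≫ j = 0) : j ⊗ₘ f = 0 := by
  apply (tensorRightHomEquiv (a ⊗ x) (ᘁy : K) y b).symm.injective
  have h1 : (tensorRightHomEquiv (a ⊗ x) (ᘁy : K) y b).symm (j ⊗ₘ f) =
      (α_ _ _ _).hom ≫ augment (counitMate f) a ≫ j := by
    simp only [tensorRightHomEquiv, Equiv.coe_fn_symm_mk, augment_naturality]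
    simp only [augment, counitMate, MonoidalCategory.tensorHom_def]
    monoidal
  rw [h1, h]
  simp [tensorRightHomEquiv]

/-- The kernel of `unitMate f` is annihilated by `f`. The morphism `z ⊗ x ⟶ x ⟶ y` given by `u`
and `f` corresponds to `u ≫ unitMate f` under the adjunction `- ⊗ x ⊣ - ⊗ xᘁ`, and
`z ⊗ x ⊗ ᘁy ⟶ z ⟶ 𝟙` factors through it. -/
lemma augment_comp_eq_zero_of_comp_unitMate_eq_zero {x y : K} (f : x ⟶ y) {z : K}
    (u : z ⟶ 𝟙_ K) (h : u ≫ unitMate f = 0) : augment (counitMate f) z ≫ u = 0 := by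
  have h1 : tensorRightHomEquiv (𝟙_ K) x (xᘁ : K) y ((λ_ x).hom ≫ f) = unitMate f := by
    simp only [tensorRightHomEquiv, Equiv.coe_fn_mk, unitMate]
    monoidal
  have h2 : u ▷ x ≫ (λ_ x).hom ≫ f = 0 := by
    apply (tensorRightHomEquiv z x (xᘁ : K) y).injective
    rw [← (tensorRightHomEquiv (𝟙_ K) x (xᘁ : K) y).symm_apply_apply ((λ_ x).hom ≫ f),
      ← tensorRightHomEquiv_symm_naturality, h1, h]
    simp [tensorRightHomEquiv]
  have h3 : augment (counitMate f) z ≫ u =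
      (α_ _ _ _).inv ≫ (u ▷ x ≫ (λ_ x).hom ≫ f) ▷ (ᘁy : K) ≫ ε_ (ᘁy : K) y := by
    rw [augment_naturality]
    simp only [augment, counitMate]
    monoidal
  rw [h3, h2]
  simp

/-- The step from `f^{⊗ n}` to `f^{⊗ (n + 1)}` in the proof of nilpotence, with `j = f^{⊗ n}`. -/
lemma tensorHom_tensorHom_eq_zero_of_augment [BraidedCategory K] {x y : K} (f : x ⟶ y)
    {a b z w : K} (j : a ⟶ b) (k : z ⟶ w)
    (h : j ⊗ₘ (augment (counitMate f) z ≫ k) = 0) : (j ⊗ₘ f) ⊗ₘ k = 0 := by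
  -- Transposition yields a vanishing with `f` as the last factor; the braiding moves it inward.
  have h1 : (j ⊗ₘ k) ⊗ₘ f = 0 := by
    apply tensorHom_eq_zero_of_augment_comp_eq_zero
    have : augment (counitMate f) (a ⊗ z) ≫ (j ⊗ₘ k) =
        (α_ _ _ _).hom ≫ (j ⊗ₘ (augment (counitMate f) z ≫ k)) := by
      rw [augment_tensor, Category.assoc, ← id_tensorHom, tensorHom_comp_tensorHom,
        Category.id_comp]
    rw [this, h, comp_zero]
  have h2 : (j ⊗ₘ f) ⊗ₘ k = (α_ a x z).hom ≫ a ◁ (β_ x z).hom ≫ (α_ a z x).inv ≫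
      ((j ⊗ₘ k) ⊗ₘ f) ≫ (α_ b w y).hom ≫ b ◁ (β_ y w).inv ≫ (α_ b y w).inv := by
    have e : f ⊗ₘ k = (β_ x z).hom ≫ (k ⊗ₘ f) ≫ (β_ y w).inv := by
      rw [← BraidedCategory.braiding_naturality_assoc, Iso.hom_inv_id, Category.comp_id]
    have e2 : j ⊗ₘ (f ⊗ₘ k) = a ◁ (β_ x z).hom ≫ (j ⊗ₘ (k ⊗ₘ f)) ≫ b ◁ (β_ y w).inv := by
      rw [e, ← id_tensorHom, ← id_tensorHom, tensorHom_comp_tensorHom, tensorHom_comp_tensorHom,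
        Category.id_comp, Category.comp_id]
    rw [← cancel_mono (α_ b y w).hom, associator_naturality, e2]
    simp only [Category.assoc, Iso.inv_hom_id, Category.comp_id]
    rw [associator_naturality_assoc, Iso.inv_hom_id_assoc]
  rw [h2, h1]
  simp

end Rigid

/-! ### Modules annihilated by a tensor power -/

section Annihilated

variable {K : Type u} [Category.{v} K] [MonoidalCategory K]

/-- The element `m ∈ M(z)` is killed by `g^{⊗ n}`: its restriction along
`z ⊗ d ⊗ ⋯ ⊗ d ⟶ z` (with `n` factors `d`) vanishes.  The recursion applies `g` once to the given
element, so no iterated tensor products appear. -/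
def KilledBy {d : K} (g : d ⟶ 𝟙_ K) (M : Kᵒᵖ ⥤ AddCommGrpCat.{v}) :
    ℕ → ∀ z : K, M.obj (op z) → Prop
  | 0, _, m => m = 0
  | n + 1, z, m => KilledBy g M n (z ⊗ d) (M.map (augment g z).op m)

variable {d : K} (g : d ⟶ 𝟙_ K)

lemma KilledBy.zero (M : Kᵒᵖ ⥤ AddCommGrpCat.{v}) (n : ℕ) (z : K) :
    KilledBy g M n z 0 := by
  induction n generalizing z with
  | zero => rfl
  | succ n ih => change KilledBy g M n _ (M.map _ 0); rw [map_zero]; exact ih _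

variable {g} {M N : Kᵒᵖ ⥤ AddCommGrpCat.{v}} {z : K}

lemma KilledBy.add {n : ℕ} {m m' : M.obj (op z)} (h : KilledBy g M n z m)
    (h' : KilledBy g M n z m') : KilledBy g M n z (m + m') := by
  induction n generalizing z with
  | zero =>
    change m + m' = 0
    rw [show m = 0 from h, show m' = 0 from h', add_zero]
  | succ n ih =>
    change KilledBy g M n _ (M.map _ (m + m'))
    rw [map_add]
    exact ih h h'

lemma KilledBy.neg {n : ℕ} {m : M.obj (op z)} (h : KilledBy g M n z m) :
    KilledBy g M n z (-m) := by
  induction n generalizing z with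
  | zero =>
    change -m = 0
    rw [show m = 0 from h, neg_zero]
  | succ n ih =>
    change KilledBy g M n _ (M.map _ (-m))
    rw [map_neg]
    exact ih h

lemma KilledBy.map {n : ℕ} {m : M.obj (op z)} (h : KilledBy g M n z m) {w : K} (u : w ⟶ z) :
    KilledBy g M n w (M.map u.op m) := by
  induction n generalizing z w with
  | zero =>
    change M.map u.op m = 0
    rw [show m = 0 from h, map_zero]
  | succ n ih =>
    change KilledBy g M n _ (M.map (augment g w).op (M.map u.op m))
    rw [← map_comp_apply, augment_naturality, map_comp_apply]
    exact ih h _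

lemma KilledBy.app {n : ℕ} {m : M.obj (op z)} (h : KilledBy g M n z m) (φ : M ⟶ N) :
    KilledBy g N n z (φ.app _ m) := by
  induction n generalizing z with
  | zero =>
    change φ.app _ m = 0
    rw [show m = 0 from h, map_zero]
  | succ n ih =>
    change KilledBy g N n _ (N.map (augment g z).op (φ.app _ m))
    rw [← nat_apply]
    exact ih h

lemma KilledBy.of_app {n : ℕ} {m : M.obj (op z)} (φ : M ⟶ N)
    (hφ : ∀ z : K, Function.Injective (φ.app (op z)))
    (h : KilledBy g N n z (φ.app _ m)) : KilledBy g M n z m := by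
  induction n generalizing z with
  | zero => exact hφ _ (Eq.trans h (map_zero _).symm)
  | succ n ih =>
    refine ih ?_
    rw [nat_apply]
    exact h

/-- In an extension the exponents add up: `n` applications of `g` bring an element of the middle
term into the submodule, where `k` more kill it. -/
lemma KilledBy.of_exact {L : Kᵒᵖ ⥤ AddCommGrpCat.{v}} (i : L ⟶ M) (p : M ⟶ N)
    (hip : ∀ (z : K) (m : M.obj (op z)), p.app _ m = 0 → ∃ l, i.app _ l = m)
    {k n : ℕ} (hL : ∀ (z : K) (l : L.obj (op z)), KilledBy g L k z l)
    {m : M.obj (op z)} (h : KilledBy g N n z (p.app _ m)) : KilledBy g M (n + k) z m := by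
  induction n generalizing z with
  | zero =>
    obtain ⟨l, rfl⟩ := hip _ _ h
    rw [Nat.zero_add]
    exact (hL _ l).app i
  | succ n ih =>
    rw [Nat.succ_add]
    refine ih ?_
    rw [nat_apply]
    exact h

lemma KilledBy.pair {T : Kᵒᵖ ⥤ AddCommGrpCat.{v}} (β : Pairing M N T) {n : ℕ} {a b : K}
    (m : M.obj (op a)) {q : N.obj (op b)} (h : KilledBy g N n b q) :
    KilledBy g T n (a ⊗ b) (β.pair a b m q) := by
  induction n generalizing b with
  | zero =>
    change β.pair a b m q = 0
    rw [show q = 0 from h, map_zero]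
  | succ n ih =>
    change KilledBy g T n _ (T.map _ _)
    rw [augment_tensor, map_comp_apply, ← id_tensorHom, β.naturality, map_id_apply]
    exact (ih h).map _

variable [Preadditive K]

lemma KilledBy.of_isDayConvolution {T : Kᵒᵖ ⥤ AddCommGrpCat.{v}} [T.Additive]
    (hT : IsDayConvolution M N T) {n : ℕ}
    (h : ∀ (z : K) (m : N.obj (op z)), KilledBy g N n z m) (t : T.obj (op z)) :
    KilledBy g T n z t := by
  obtain ⟨β, hβ⟩ := hT
  exact hβ.mem_of_pair_mem
    (fun z =>
      { carrier := {t | KilledBy g T n z t}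
        add_mem' := KilledBy.add
        zero_mem' := KilledBy.zero g T n z
        neg_mem' := KilledBy.neg })
    (fun u _ ht => KilledBy.map ht u) (fun _ _ m q => (h _ q).pair β m) z t

/-- Over a rigid category, a morphism `k` killed by `n` applications of the transpose of `f`
satisfies `f^{⊗ n} ⊗ k = 0`. -/
lemma tensorPowMap_tensorHom_eq_zero_of_killedBy [BraidedCategory K] [RigidCategory K]
    [MonoidalPreadditive K] {x y : K} (f : x ⟶ y) {n : ℕ} {z w : K} (k : z ⟶ w)
    (h : KilledBy (counitMate f) (preadditiveYoneda.obj w) n z k) :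
    tensorPowMap f n ⊗ₘ k = 0 := by
  induction n generalizing z with
  | zero =>
    rw [show k = 0 from h]
    exact MonoidalPreadditive.tensor_zero _
  | succ n ih => exact tensorHom_tensorHom_eq_zero_of_augment f _ k (ih _ h)

/-- The class of modules all of whose elements are killed by `g^{⊗ n}`, for a common `n`. For
`g = counitMate f` these are the modules `M` with `f^{⊗ n} ⊗ M = 0` for some `n`. -/
def annihilated (g : d ⟶ 𝟙_ K) : ObjectProperty (FreydEnvelope K) := fun M =>
  ∃ n : ℕ, ∀ (z : K) (m : M.obj.obj (op z)), KilledBy g M.obj n z m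

variable (g)

lemma annihilated_isTensorIdeal [HasBinaryBiproducts K] [MonoidalPreadditive K] :
    IsTensorIdeal (annihilated g) := by
  rintro M N ⟨n, hn⟩
  have := (tensorObj M N).additive
  exact ⟨n, fun z t => KilledBy.of_isDayConvolution (isDayConvolution_tensorObj M N) hn t⟩

open ZeroObject in
instance annihilated_isSerreClass [HasZeroObject K] [HasBinaryBiproducts K] [HasWeakKernels K] :
    (annihilated g).IsSerreClass where
  exists_zero := by
    refine ⟨(yonedaEmbedding K).obj 0, ?_, 0, fun z m => (isZero_zero K).eq_of_tgt _ _⟩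
    rw [IsZero.iff_id_eq_zero]
    exact yoneda_hom_ext ((isZero_zero K).eq_of_tgt _ _)
  prop_of_mono i _ := by
    rintro ⟨n, hn⟩
    exact ⟨n, fun z m => KilledBy.of_app i.hom (app_injective_of_mono i) (hn _ _)⟩
  prop_of_epi p _ := by
    rintro ⟨n, hn⟩
    refine ⟨n, fun z m => ?_⟩
    obtain ⟨m, rfl⟩ := app_surjective_of_epi p z m
    exact (hn z m).app p.hom
  prop_X₂_of_shortExact := by
    rintro S hS ⟨k, hk⟩ ⟨n, hn⟩
    exact ⟨n + k, fun z m => KilledBy.of_exact S.f.hom S.g.hom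
      (fun _ => exists_app_eq_of_shortExact hS) hk (hn z _)⟩

end Annihilated

/-! ### Morphisms factoring through a Serre tensor ideal -/

section Ideals

variable {K : Type u} [Category.{v} K] [Preadditive K] [HasZeroObject K]

/-- The morphism `h(f)` factors through an object of `B`. -/
def FactorsThrough (B : ObjectProperty (FreydEnvelope K)) {p q : K} (f : p ⟶ q) : Prop :=
  ∃ (N : FreydEnvelope K) (_ : B N) (s : (yonedaEmbedding K).obj p ⟶ N)
    (t : N ⟶ (yonedaEmbedding K).obj q), s ≫ t = (yonedaEmbedding K).map f

variable {B : ObjectProperty (FreydEnvelope K)}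

lemma FactorsThrough.precomp {p q : K} {f : p ⟶ q} (h : FactorsThrough B f) {r : K} (k : r ⟶ p) :
    FactorsThrough B (k ≫ f) := by
  obtain ⟨N, hN, s, t, hst⟩ := h
  exact ⟨N, hN, (yonedaEmbedding K).map k ≫ s, t, by rw [Category.assoc, hst, Functor.map_comp]⟩

lemma FactorsThrough.postcomp {p q : K} {f : p ⟶ q} (h : FactorsThrough B f) {r : K} (k : q ⟶ r) :
    FactorsThrough B (f ≫ k) := by
  obtain ⟨N, hN, s, t, hst⟩ := h
  exact ⟨N, hN, s, t ≫ (yonedaEmbedding K).map k, by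
    rw [← Category.assoc, hst, Functor.map_comp]⟩

/-- If `h(f) : h(p) ⟶ h(q)` factors through `s : h(p) ⟶ N` with `N` in `B`, then `kernel s` is a
subobject of `kernel h(f)`, so `h(p)` is an extension of two objects of `B`. -/
lemma FactorsThrough.prop_yoneda [HasBinaryBiproducts K] [HasWeakKernels K]
    [B.IsSerreClass] {p q : K} {f : p ⟶ q} (h : FactorsThrough B f)
    (hf : B (kernel ((yonedaEmbedding K).map f))) : B ((yonedaEmbedding K).obj p) := by
  obtain ⟨N, hN, s, t, hst⟩ := h
  have h1 : B (kernel s) := by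
    let j : kernel s ⟶ kernel ((yonedaEmbedding K).map f) :=
      kernel.lift _ (kernel.ι s) (by rw [← hst, kernel.condition_assoc, zero_comp])
    have : Mono (j ≫ kernel.ι ((yonedaEmbedding K).map f)) := by
      rw [kernel.lift_ι]; infer_instance
    have : Mono j := mono_of_mono j (kernel.ι _)
    exact B.prop_of_mono j hf
  exact B.prop_X₂_of_exact (ShortComplex.exact_kernel s) h1 hN

variable [MonoidalCategory K] [HasBinaryBiproducts K] [MonoidalPreadditive K]

/-- If `h(f)` factors through `N`, then `h(a ◁ f)` factors through `h(a) ⊗ N`: the first morphism is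
the element `𝟙 ⊗ s` of `(h(a) ⊗ N)(a ⊗ p)`, the second comes from the pairing `(u, n) ↦ u ⊗ t(n)`. -/
lemma FactorsThrough.whiskerLeft (hB : IsTensorIdeal B) {p q : K} {f : p ⟶ q}
    (h : FactorsThrough B f) (a : K) : FactorsThrough B (a ◁ f) := by
  obtain ⟨N, hN, s, t, hst⟩ := h
  let A := (yonedaEmbedding K).obj a
  obtain ⟨β, hβ⟩ := isDayConvolution_tensorObj A N
  let γ : Pairing A.obj N.obj (preadditiveYoneda.obj (a ⊗ q)) :=
    { pair := fun b c => AddMonoidHom.mk' (fun u : b ⟶ a => AddMonoidHom.mk'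
        (fun n : N.obj.obj (op c) =>
          (u ⊗ₘ (t.hom.app (op c) n : c ⟶ q) : b ⊗ c ⟶ a ⊗ q))
        (fun n n' => by
          rw [map_add]
          exact MonoidalPreadditive.tensor_add _ _ _))
        (fun u u' => by
          ext n
          exact MonoidalPreadditive.add_tensor _ _ _)
      naturality := by
        intro b b' c c' v w u n
        have h1 : (t.hom.app (op c') (N.obj.map w.op n) : c' ⟶ q) =
            w ≫ (t.hom.app (op c) n : c ⟶ q) := nat_apply t.hom w n
        change (v ⊗ₘ w) ≫ (u ⊗ₘ (t.hom.app (op c) n : c ⟶ q)) =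
          (v ≫ u) ⊗ₘ (t.hom.app (op c') (N.obj.map w.op n) : c' ⟶ q)
        rw [h1]
        exact tensorHom_comp_tensorHom _ _ _ _ }
  obtain ⟨φ, hφ, -⟩ := hβ _ γ
  refine ⟨tensorObj A N, hB _ _ hN,
    (tensorObj A N).ofElement (β.pair a p (𝟙 a) (s.hom.app (op p) (𝟙 p))),
    ObjectProperty.homMk φ, yoneda_hom_ext ?_⟩
  have h2 : (t.hom.app (op p) (s.hom.app (op p) (𝟙 p)) : p ⟶ q) = f :=
    (congr_arg (fun χ => χ.hom.app (op p) (𝟙 p)) hst).trans (Category.id_comp f)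
  have h3 : (𝟙 a ⊗ₘ (t.hom.app (op p) (s.hom.app (op p) (𝟙 p)) : p ⟶ q)) =
      𝟙 (a ⊗ p) ≫ a ◁ f := by
    rw [h2, id_tensorHom, Category.id_comp]
  exact (congr_arg _ (map_id_apply _ _)).trans ((hφ _ _ _ _).trans h3)

lemma FactorsThrough.whiskerRight [BraidedCategory K] (hB : IsTensorIdeal B) {p q : K} {f : p ⟶ q}
    (h : FactorsThrough B f) (a : K) : FactorsThrough B (f ▷ a) := by
  have h1 : f ▷ a = (β_ p a).hom ≫ a ◁ f ≫ (β_ q a).inv := by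
    rw [← BraidedCategory.braiding_naturality_left_assoc, Iso.hom_inv_id, Category.comp_id]
  rw [h1]
  exact ((h.whiskerLeft hB a).postcomp _).precomp _

variable [HasWeakKernels K]

/-- A Serre `⊗`-ideal containing the unit contains everything: it contains every `h(a)`, and every
module is a quotient of some `h(a)`. -/
lemma eq_top_of_unit_mem [B.IsSerreClass] (hB : IsTensorIdeal B)
    (h : B ((yonedaEmbedding K).obj (𝟙_ K))) : B = ⊤ := by
  have h1 : FactorsThrough B (𝟙 (𝟙_ K)) := ⟨_, h, 𝟙 _, 𝟙 _, by simp⟩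
  refine top_unique fun M _ => ?_
  obtain ⟨a, p, _⟩ := exists_epi_yoneda M
  have h2 : FactorsThrough B (𝟙 a) := by
    have := ((h1.whiskerLeft hB a).postcomp (ρ_ a).hom).precomp (ρ_ a).inv
    simpa using this
  obtain ⟨N, hN, s, t, hst⟩ := h2
  have : Mono s := by
    have : Mono (s ≫ t) := by rw [hst]; infer_instance
    exact mono_of_mono s t
  exact B.prop_of_epi p (B.prop_of_mono s hN)

lemma annihilated_kernel_unitMate [RigidCategory K] {x y : K} (f : x ⟶ y) :
    annihilated (counitMate f) (kernel ((yonedaEmbedding K).map (unitMate f))) := by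
  refine ⟨1, fun z m => ?_⟩
  let i := kernel.ι ((yonedaEmbedding K).map (unitMate f))
  refine KilledBy.of_app i.hom (app_injective_of_mono i) ?_
  let u : z ⟶ 𝟙_ K := i.hom.app (op z) m
  refine augment_comp_eq_zero_of_comp_unitMate_eq_zero f u ?_
  exact congr_arg (fun χ => χ.hom.app (op z) m)
    (kernel.condition ((yonedaEmbedding K).map (unitMate f)))

end Ideals

/-! ### Homological primes and the nilpotence theorem -/

section TensorTriangulated

variable {K : Type u} [Category.{v} K] [Preadditive K] [HasZeroObject K] [HasShift K ℤ]
  [∀ n : ℤ, (shiftFunctor K n).Additive] [Pretriangulated K] [MonoidalCategory K]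
  [IsTensorExact K]

/-- Every proper Serre `⊗`-ideal is contained in a homological prime. Properness amounts to not
containing the unit, a condition that passes to unions of chains. -/
lemma exists_homologicalPrime_le (C : ObjectProperty (FreydEnvelope K)) [hCS : C.IsSerreClass]
    (hC : IsTensorIdeal C) (hC' : C ≠ ⊤) :
    ∃ B : ObjectProperty (FreydEnvelope K), IsHomologicalPrime B ∧ C ≤ B := by
  obtain ⟨B, hCB, ⟨hBS, hB, hB1⟩, hmax⟩ := zorn_le_nonempty₀
    {B : ObjectProperty (FreydEnvelope K) | B.IsSerreClass ∧ IsTensorIdeal B ∧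
      ¬ B ((yonedaEmbedding K).obj (𝟙_ K))} (by
    intro c hc hchain D hD
    refine ⟨sSup c, ⟨?_, ?_, ?_⟩, fun _ => le_sSup⟩
    · refine { exists_zero := ?_, prop_of_mono := ?_, prop_of_epi := ?_,
               prop_X₂_of_shortExact := ?_ }
      · have := (hc hD).1
        obtain ⟨Z, hZ, hZ'⟩ := D.exists_prop_of_containsZero
        exact ⟨Z, hZ, le_sSup hD _ hZ'⟩
      · intro X Y i _ hY
        simp only [sSup_apply, iSup_Prop_eq] at hY ⊢
        obtain ⟨E, hY⟩ := hY
        have := (hc E.2).1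
        exact ⟨E, ObjectProperty.prop_of_mono E.1 i hY⟩
      · intro X Y p _ hX
        simp only [sSup_apply, iSup_Prop_eq] at hX ⊢
        obtain ⟨E, hX⟩ := hX
        have := (hc E.2).1
        exact ⟨E, ObjectProperty.prop_of_epi E.1 p hX⟩
      · intro S hS h1 h3
        simp only [sSup_apply, iSup_Prop_eq] at h1 h3 ⊢
        obtain ⟨E, h1⟩ := h1
        obtain ⟨F, h3⟩ := h3
        have := (hc E.2).1
        have := (hc F.2).1
        rcases hchain.total E.2 F.2 with h | h
        · exact ⟨F, ObjectProperty.prop_X₂_of_shortExact F.1 hS (h _ h1) h3⟩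
        · exact ⟨E, ObjectProperty.prop_X₂_of_shortExact E.1 hS h1 (h _ h3)⟩
    · intro M N hN
      simp only [sSup_apply, iSup_Prop_eq] at hN ⊢
      obtain ⟨E, hN⟩ := hN
      exact ⟨E, (hc E.2).2.1 M N hN⟩
    · simp only [sSup_apply, iSup_Prop_eq, not_exists]
      exact fun E => (hc E.2).2.2) C
    ⟨hCS, hC, fun h => hC' (eq_top_of_unit_mem hC h)⟩
  exact ⟨B, { isTensorIdeal := hB
              ne_top := fun h => hB1 (by rw [h]; trivial)
              eq_of_le := fun D _ hD hD' hBD => le_antisymm hBD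
                (hmax ⟨‹_›, hD, fun h => hD' (eq_top_of_unit_mem hD h)⟩ hBD) }, hCB⟩

lemma factorsThrough_of_homologicalResidueField_map_eq_zero
    (B : ObjectProperty (FreydEnvelope K)) [IsHomologicalPrime B] {x y : K} (f : x ⟶ y)
    (h : (homologicalResidueField B).map f = 0) : FactorsThrough B f :=
  ⟨Abelian.image ((yonedaEmbedding K).map f),
    (ObjectProperty.SerreClassLocalization.map_eq_zero_iff B.isoModSerre.Q B _).1 h,
    Abelian.factorThruImage _, Abelian.image.ι _, by simp⟩

end TensorTriangulated

end TTNilpotence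

theorem corollary4p5 {K : Type u} [Category.{v} K] [EssentiallySmall.{w} K]
    [Preadditive K] [HasZeroObject K] [HasShift K ℤ]
    [∀ n : ℤ, (shiftFunctor K n).Additive] [Pretriangulated K] [IsTriangulated K]
    [MonoidalCategory K] [SymmetricCategory K] [TTNilpotence.IsTensorExact K] [RigidCategory K]
    {x y : K} (f : x ⟶ y)
    (hf : ∀ (B : ObjectProperty (TTNilpotence.FreydEnvelope K))
      [TTNilpotence.IsHomologicalPrime B],
      (TTNilpotence.homologicalResidueField B).map f = 0) :
    ∃ n : ℕ, 1 ≤ n ∧ TTNilpotence.tensorPowMap f n = 0 := by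
  open TTNilpotence in
  by_cases htop : annihilated (counitMate f) = ⊤
  · obtain ⟨n, hn⟩ : annihilated (counitMate f) ((yonedaEmbedding K).obj (𝟙_ K)) := by
      rw [htop]; trivial
    have h1 : tensorPowMap f n ⊗ₘ 𝟙 (𝟙_ K) = 0 :=
      tensorPowMap_tensorHom_eq_zero_of_killedBy f _ (hn _ (𝟙 (𝟙_ K)))
    have h2 : tensorPowMap f n = 0 := by
      rw [tensorHom_id] at h1
      rw [← cancel_epi (ρ_ _).hom, ← rightUnitor_naturality, h1, zero_comp, comp_zero]
    -- The exponent found may be `0`, so one more factor is added.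
    refine ⟨n + 1, Nat.le_add_left 1 n, ?_⟩
    change tensorPowMap f n ⊗ₘ f = 0
    rw [h2, MonoidalPreadditive.zero_tensor]
  · obtain ⟨B, _, hB⟩ := exists_homologicalPrime_le _ (annihilated_isTensorIdeal _) htop
    have hBt := IsHomologicalPrime.isTensorIdeal (B := B)
    have h1 : FactorsThrough B (unitMate f) :=
      ((factorsThrough_of_homologicalResidueField_map_eq_zero B f (hf B)).whiskerRight
        hBt _).precomp _
    exact absurd (eq_top_of_unit_mem hBt
      (h1.prop_yoneda (hB _ (annihilated_kernel_unitMate f)))) IsHomologicalPrime.ne_top
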